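/- Let $\alpha>-1$ and $\theta>0$. For $N\ge 0$ let $$w_N(x)=\prod_{1\le i<j\le N}(x_i-x_j)(x_i^{\theta}-x_j^{\theta})\prod_{i=1}^N x_i^{\alpha}e^{-x_i},\qquad x\in(0,\infty)^N,\qquad Z_N=\int_{(0,\infty)^N}w_N(x)\,dx .$$ The $N$-point biorthogonal Laguerre ensemble with parameters $(\alpha,\theta)$ has joint probability density $p_N=w_N/Z_N$ on $(0,\infty)^N$. For $n\le N$ its correlation functions are $$\rho_{n,N}(x_1,\dots,x_n)=\frac{N!}{(N-n)!}\int_{(0,\infty)^{N-n}}p_N(x_1,\dots,x_N)\,dx_{n+1}\cdots dx_N .$$ For $x,y>0$ put $$\mathcal K^{(\alpha,\theta)}(x,y)=\sum_{k,l=0}^{\infty}\frac{(-1)^kx^k}{k!\,\Gamma\left(\frac{\alpha+1+k}{\theta}\right)}\,\frac{(-1)^l y^{\theta l}}{l!\,\Gamma(\alpha+1+\theta l)}\,\frac{\theta}{\alpha+1+k+\theta l},$$ and for $n\ge1$ let $$\rho_n^{(\alpha,\theta)}(x_1,\dots,x_n)=\prod_{i=1}^n x_i^{\alpha}\cdot\det\left[\mathcal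 K^{(\alpha,\theta)}(x_i,x_j)\right]_{i,j=1}^n,\qquad x\in(0,\infty)^n,$$ and let $M_n^{(\alpha,\theta)}=\rho_n^{(\alpha,\theta)}(x_1,\dots,x_n)\,dx_1\cdots dx_n$, a measure on $(0,\infty)^n$. Then the following hold. 1. For every $N\ge0$ the function $w_N$ is integrable on $(0,\infty)^N$ and $Z_N>0$. 2. For all $x,y>0$ the double series for $\mathcal K^{(\alpha,\theta)}(x,y)$ converges absolutely, and $$\mathcal K^{(\alpha,\theta)}\left(y^{1/\theta},x^{1/\theta}\right)=\theta\,\mathcal K^{\left(\frac{\alpha+1}{\theta}-1,\frac1\theta\right)}(x,y).$$ 3. For every $n\ge1$ and every $x\in(0,\infty)^n$ the limit of the correlation functions at the left edge of the spectrum exists and is given by $$\lim_{N\to\infty}\frac1{N^{n/\theta}}\,\rho_{n,N}\left(\frac{x_1}{N^{1/\theta}},\dots,\frac{x_n}{N^{1/\theta}}\right)=\rho_n^{(\alpha,\theta)}(x_1,\dots,x_n)\ge 0 .$$ 4. For every $n\ge1$ the limiting edge correlation measures are invariant under the change of parameters $\alpha\mapsto\frac{\alpha+1}{\theta}-1$,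 $\theta\mapsto\frac1\theta$ combined with the transformation $x\mapsto x^{1/\theta}$ of the phase space: the push-forward of $M_n^{\left(\frac{\alpha+1}{\theta}-1,\frac1\theta\right)}$ under $(x_1,\dots,x_n)\mapsto(x_1^{1/\theta},\dots,x_n^{1/\theta})$ is $M_n^{(\alpha,\theta)}$. Equivalently, the push-forward of $M_n^{(\alpha,\theta)}$ under $(x_1,\dots,x_n)\mapsto(x_1^{\theta},\dots,x_n^{\theta})$ is $M_n^{\left(\frac{\alpha+1}{\theta}-1,\frac1\theta\right)}$. -/

import Mathlib

open MeasureTheory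

noncomputable section

namespace LaguerreBE

/-- The open orthant `(0, ∞)^n`. -/
def orthant (n : ℕ) : Set (Fin n → ℝ) :=
  {x | ∀ i, 0 < x i}

/-- The unnormalized joint density
`∏_{i<j} (x_i - x_j) (x_i^θ - x_j^θ) · ∏_i x_i^α e^{-x_i}` of the biorthogonal Laguerre ensemble;
it is only used on the open orthant. -/
def weight (α θ : ℝ) {N : ℕ} (x : Fin N → ℝ) : ℝ :=
  (∏ i, ∏ j ∈ Finset.Ioi i, ((x i - x j) * (x i ^ θ - x j ^ θ))) *
    ∏ i, (x i ^ α * Real.exp (-x i))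

/-- The normalization integral of the `N`-point ensemble. -/
def partitionFunction (α θ : ℝ) (N : ℕ) : ℝ :=
  ∫ x in orthant N, weight α θ x

/-- The joint probability density on `(0, ∞)^N` of the `N`-point biorthogonal Laguerre ensemble. -/
def jointDensity (α θ : ℝ) {N : ℕ} (x : Fin N → ℝ) : ℝ :=
  (partitionFunction α θ N)⁻¹ * weight α θ x

/-- The `n`-th correlation function of the `N`-point biorthogonal Laguerre ensemble,
`N! / (N - n)! · ∫ p_N(x_1, …, x_N) dx_{n+1} ⋯ dx_N`, the integral being over `(0, ∞)^(N-n)`.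
Here `N.descFactorial n` is `N! / (N - n)!` for `n ≤ N` (then `n + (N - n) = N`) and is `0` for
`N < n`. -/
def correlation (α θ : ℝ) (N n : ℕ) (x : Fin n → ℝ) : ℝ :=
  (N.descFactorial n : ℝ) *
    ∫ y in orthant (N - n), jointDensity α θ (Fin.append x y)

/-- The `n`-th correlation function rescaled at the left edge of the spectrum:
`N^{-n/θ} ρ_{n,N}(x_1 / N^{1/θ}, …, x_n / N^{1/θ})`. -/
def scaledCorrelation (α θ : ℝ) (N n : ℕ) (x : Fin n → ℝ) : ℝ :=
  1 / (N : ℝ) ^ ((n : ℝ) / θ) *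
    correlation α θ N n (fun i => x i / (N : ℝ) ^ (1 / θ))

/-- The `(k, l)` term of the double series defining the limit kernel. -/
def kernelTerm (α θ x y : ℝ) (p : ℕ × ℕ) : ℝ :=
  ((-1) ^ p.1 * x ^ p.1) / ((p.1.factorial : ℝ) * Real.Gamma ((α + 1 + p.1) / θ)) *
    (((-1) ^ p.2 * y ^ (θ * p.2)) / ((p.2.factorial : ℝ) * Real.Gamma (α + 1 + θ * p.2))) *
    (θ / (α + 1 + p.1 + θ * p.2))

/-- The limit kernel `𝒦^{(α,θ)}(x, y)`. -/
def kernel (α θ x y : ℝ) : ℝ :=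
  ∑' p : ℕ × ℕ, kernelTerm α θ x y p

/-- The limit correlation function `∏_i x_i^α · det [𝒦^{(α,θ)}(x_i, x_j)]`. -/
def edgeCorrelation (α θ : ℝ) (n : ℕ) (x : Fin n → ℝ) : ℝ :=
  (∏ i, x i ^ α) * (Matrix.of fun i j : Fin n => kernel α θ (x i) (x j)).det

/-- The limit correlation measure on `(0, ∞)^n`, viewed as a measure on `ℝ^n` carried by the open
orthant. -/
def edgeMeasure (α θ : ℝ) (n : ℕ) : Measure (Fin n → ℝ) :=
  (volume.restrict (orthant n)).withDensity fun x => ENNReal.ofReal (edgeCorrelation α θ n x)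

/-- The transformation `x ↦ x^c` of the phase space, applied to every point of a configuration. -/
def powMap (c : ℝ) (n : ℕ) (x : Fin n → ℝ) : Fin n → ℝ :=
  fun i => x i ^ c

end LaguerreBE

end

open MeasureTheory

noncomputable section

namespace LaguerreBE

open Filter Topology

/-! The weight is a product of two Vandermonde determinants, in `x` and in `x ^ θ`, so the ensemble
is determinantal. Its kernel involves the inverse of the Gram matrix `Γ(α + 1 + m + θ l)`, which is
explicit: dividing by `Γ(α + 1 + θ l)` leaves a polynomial in `l`, inverted by Lagrange
interpolation at `0, …, N - 1` and then binomial inversion (`sum_gramInv_mul_Gamma`).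
Biorthonormality lets points be integrated out of the determinant (`integral_det_kernelMatrix`),
which gives `correlation_eq_det` and, with no points left, the partition function.

In the edge scaling each kernel coefficient is a finite sum of ratios of rising factorials. Euler's
limit for Gamma leaves one surviving summand (`tendsto_scaledCoeff`), and a bound uniform in `N`
(`abs_scaledCoeff_le`) permits dominated convergence of the double series. Limits of determinants
follow by continuity, nonnegativity by passing to the limit.

The symmetry exchanges the two summation indices (`kernel_symm`). The invariance of the measures is
then a change of variables whose Jacobian absorbs the factor `θ` and the change of exponent. -/

/-- Schur expansion of a bordered determinant, without an invertibility hypothesis. -/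
theorem det_fromBlocks_border {ι : Type} [Fintype ι] [DecidableEq ι] (A : Matrix ι ι ℝ)
    (B : Matrix ι Unit ℝ) (C : Matrix Unit ι ℝ) (D : Matrix Unit Unit ℝ) :
    (Matrix.fromBlocks A B C D).det = (A.det • D - C * A.adjugate * B).det := by
  -- the identity holds after multiplication by a power of `det A`
  have key : ∀ {R : Type} [CommRing R] [IsDomain R] (A : Matrix ι ι R) (B : Matrix ι Unit R)
      (C : Matrix Unit ι R) (D : Matrix Unit Unit R), A.det ≠ 0 →
      (Matrix.fromBlocks A B C D).det = (A.det • D - C * A.adjugate * B).det := by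
    intro R _ _ A B C D hA
    have h : Matrix.fromBlocks A B C D *
        Matrix.fromBlocks A.adjugate (-(A.adjugate * B)) 0 (A.det • 1) =
        Matrix.fromBlocks (A.det • 1) 0 (C * A.adjugate) (A.det • D - C * A.adjugate * B) := by
      rw [Matrix.fromBlocks_multiply]
      congr 1
      · simp [Matrix.mul_adjugate]
      · rw [Matrix.mul_neg, ← Matrix.mul_assoc, Matrix.mul_adjugate]; simp
      · simp
      · simp [Matrix.mul_assoc, sub_eq_add_neg, add_comm]
    have h' := congrArg Matrix.det h
    rw [Matrix.det_mul, Matrix.det_fromBlocks_zero₂₁, Matrix.det_fromBlocks_zero₁₂] at h'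
    have hpow : A.adjugate.det * (A.det • (1 : Matrix Unit Unit R)).det =
        (A.det • (1 : Matrix ι ι R)).det := by
      rw [← Matrix.mul_adjugate, Matrix.det_mul]
      simp [mul_comm]
    rw [hpow, mul_comm] at h'
    refine mul_left_cancel₀ ?_ h'
    simp [hA]
  -- Replacing `A` by `X + A` over `ℝ[X]` makes the determinant nonzero, being the characteristic
  -- polynomial of `-A`; evaluation at `X = 0` then recovers the singular case.
  have hX : (Matrix.scalar ι (Polynomial.X : Polynomial ℝ) + A.map Polynomial.C).det ≠ 0 := by
    have := (Matrix.charpoly_monic (-A)).ne_zero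
    rw [Matrix.charpoly, Matrix.charmatrix] at this
    convert this using 2
    ext i j
    simp
  have h := key _ (B.map Polynomial.C) (C.map Polynomial.C) (D.map Polynomial.C) hX
  have h0 := congrArg (Polynomial.evalRingHom (0 : ℝ)) h
  rw [RingHom.map_det, RingHom.map_det] at h0
  have e1 : (Polynomial.evalRingHom (0 : ℝ)).mapMatrix
      (Matrix.scalar ι (Polynomial.X : Polynomial ℝ) + A.map Polynomial.C) = A := by
    ext i j
    by_cases hij : i = j <;> simp [Matrix.diagonal, hij]
  have e2 : ∀ {m n : Type} (E : Matrix m n ℝ),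
      (E.map Polynomial.C).map (Polynomial.evalRingHom (0 : ℝ)) = E := by
    intro m n E; ext i j; simp
  convert h0 using 2
  · simp only [RingHom.mapMatrix_apply, Matrix.fromBlocks_map] at e1 ⊢
    rw [e1, e2, e2, e2]
  · have e3 := RingHom.map_det (Polynomial.evalRingHom (0 : ℝ))
      (Matrix.scalar ι (Polynomial.X : Polynomial ℝ) + A.map Polynomial.C)
    have e4 := RingHom.map_adjugate (Polynomial.evalRingHom (0 : ℝ))
      (Matrix.scalar ι (Polynomial.X : Polynomial ℝ) + A.map Polynomial.C)
    rw [e1] at e3 e4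
    rw [RingHom.mapMatrix_apply, Matrix.map_sub _ (fun a b => map_sub _ a b), Matrix.map_mul,
      Matrix.map_mul, e2, e2, ← RingHom.mapMatrix_apply _ (Matrix.adjugate _), e4]
    congr 1
    ext i j
    simp only [Matrix.map_apply, Matrix.smul_apply, smul_eq_mul, map_mul]
    rw [e3]; simp

/-! ### Integrating points out of finite rank determinants -/

section Determinantal

variable {X : Type*} {N : ℕ}

/-- The matrix of the finite rank kernel `∑ r, φ r x * ψ r y` at a family of points. -/
def kernelMatrix (φ ψ : Fin N → X → ℝ) {κ : Type} (z : κ → X) : Matrix κ κ ℝ :=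
  Matrix.of fun i j => ∑ r, φ r (z i) * ψ r (z j)

theorem det_kernelMatrix_comp_equiv (φ ψ : Fin N → X → ℝ) {κ κ' : Type} [Fintype κ]
    [DecidableEq κ] [Fintype κ'] [DecidableEq κ'] (e : κ' ≃ κ) (z : κ → X) :
    (kernelMatrix φ ψ (z ∘ e)).det = (kernelMatrix φ ψ z).det := by
  rw [← Matrix.det_submatrix_equiv_self e]
  rfl

variable [MeasurableSpace X]

/-- Integrating one point out of a determinant with a reproducing kernel. -/
theorem integral_det_kernelMatrix_unit {μ : Measure X} {φ ψ : Fin N → X → ℝ}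
    (hint : ∀ r s, Integrable (fun x => φ r x * ψ s x) μ)
    (horth : ∀ r s, ∫ x, φ r x * ψ s x ∂μ = if r = s then 1 else 0)
    {ι : Type} [Fintype ι] [DecidableEq ι] (x : ι → X) :
    ∫ y, (kernelMatrix φ ψ (Sum.elim x fun _ : Unit => y)).det ∂μ =
      ((N : ℝ) - Fintype.card ι) * (kernelMatrix φ ψ x).det := by
  set A := kernelMatrix φ ψ x with hA
  have hdet : ∀ y, (kernelMatrix φ ψ (Sum.elim x fun _ : Unit => y)).det =
      A.det * (∑ r, φ r y * ψ r y) -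
        ∑ i, ∑ j, ∑ r, ∑ s, A.adjugate i j * (φ s (x j) * ψ r (x i)) * (φ r y * ψ s y) := by
    intro y
    have : kernelMatrix φ ψ (Sum.elim x fun _ : Unit => y) = Matrix.fromBlocks A
        (Matrix.of fun i _ => ∑ r, φ r (x i) * ψ r y)
        (Matrix.of fun _ j => ∑ r, φ r y * ψ r (x j))
        (Matrix.of fun _ _ => ∑ r, φ r y * ψ r y) := by
      ext (i | i) (j | j) <;> rfl
    rw [this, det_fromBlocks_border, Matrix.det_unique]
    simp only [Matrix.sub_apply, Matrix.smul_apply, Matrix.of_apply, smul_eq_mul, Matrix.mul_apply]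
    congr 1
    rw [Finset.sum_congr rfl fun j _ => Finset.sum_mul _ _ _, Finset.sum_comm]
    refine Finset.sum_congr rfl fun i _ => Finset.sum_congr rfl fun j _ => ?_
    rw [mul_assoc, Finset.sum_mul]
    refine Finset.sum_congr rfl fun r _ => ?_
    rw [Finset.mul_sum, Finset.mul_sum]
    refine Finset.sum_congr rfl fun s _ => ?_
    ring
  simp_rw [hdet]
  have hi1 : Integrable (fun y => A.det * ∑ r, φ r y * ψ r y) μ :=
    (integrable_finsetSum _ fun r _ => hint r r).const_mul _
  have hi2 : ∀ i j r s, Integrable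
      (fun y => A.adjugate i j * (φ s (x j) * ψ r (x i)) * (φ r y * ψ s y)) μ :=
    fun i j r s => (hint r s).const_mul _
  rw [integral_sub hi1 (integrable_finsetSum _ fun i _ => integrable_finsetSum _ fun j _ =>
    integrable_finsetSum _ fun r _ => integrable_finsetSum _ fun s _ => hi2 i j r s)]
  rw [integral_const_mul, integral_finsetSum _ fun r _ => hint r r]
  -- The reproducing property `∫ K(x_j, y) K(y, x_i) dy = K(x_j, x_i)`, from biorthonormality; the
  -- diagonal term `∫ K(y, y) dy` gives `N`.
  have h2 : (∫ y, ∑ i, ∑ j, ∑ r, ∑ s,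
      A.adjugate i j * (φ s (x j) * ψ r (x i)) * (φ r y * ψ s y) ∂μ) =
      ∑ i, ∑ j, A.adjugate i j * A j i := by
    rw [integral_finsetSum _ fun i _ => integrable_finsetSum _ fun j _ =>
      integrable_finsetSum _ fun r _ => integrable_finsetSum _ fun s _ => hi2 i j r s]
    refine Finset.sum_congr rfl fun i _ => ?_
    rw [integral_finsetSum _ fun j _ =>
      integrable_finsetSum _ fun r _ => integrable_finsetSum _ fun s _ => hi2 i j r s]
    refine Finset.sum_congr rfl fun j _ => ?_
    rw [integral_finsetSum _ fun r _ => integrable_finsetSum _ fun s _ => hi2 i j r s]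
    rw [show A j i = ∑ r, φ r (x j) * ψ r (x i) from rfl, Finset.mul_sum]
    refine Finset.sum_congr rfl fun r _ => ?_
    rw [integral_finsetSum _ fun s _ => hi2 i j r s]
    simp_rw [integral_const_mul, horth]
    simp
  rw [h2]
  have h3 : ∑ i, ∑ j, A.adjugate i j * A j i = Fintype.card ι * A.det := by
    have := congrArg Matrix.trace (Matrix.adjugate_mul A)
    rw [Matrix.trace_smul, Matrix.trace_one] at this
    simpa [Matrix.trace, Matrix.mul_apply, mul_comm] using this
  rw [h3]
  simp only [horth, if_true, Finset.sum_const, Finset.card_univ, Fintype.card_fin, nsmul_eq_mul,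
    mul_one]
  ring

/-- The determinant of a finite rank kernel is integrable in any subfamily of the points. -/
theorem integrable_det_kernelMatrix {μ : Measure X} [SigmaFinite μ] {φ ψ : Fin N → X → ℝ}
    (hint : ∀ r s, Integrable (fun x => φ r x * ψ s x) μ)
    {ι : Type} [Fintype ι] [DecidableEq ι] (x : ι → X) {κ : Type} [Fintype κ] [DecidableEq κ] :
    Integrable (fun y : κ → X => (kernelMatrix φ ψ (Sum.elim x y)).det)
      (Measure.pi fun _ => μ) := by
  have hdet : ∀ y : κ → X, (kernelMatrix φ ψ (Sum.elim x y)).det =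
      ∑ σ : Equiv.Perm (ι ⊕ κ), ∑ f : (ι ⊕ κ) → Fin N,
        ((Equiv.Perm.sign σ : ℤ) : ℝ) *
          (∏ i, φ (f (σ.symm (.inl i))) (x i) * ψ (f (.inl i)) (x i)) *
          ∏ j, φ (f (σ.symm (.inr j))) (y j) * ψ (f (.inr j)) (y j) := by
    intro y
    rw [Matrix.det_apply']
    refine Finset.sum_congr rfl fun σ _ => ?_
    simp only [kernelMatrix, Matrix.of_apply]
    rw [Finset.prod_univ_sum, Finset.mul_sum, Fintype.piFinset_univ]
    refine Finset.sum_congr rfl fun f _ => ?_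
    rw [mul_assoc]
    congr 1
    -- Reindexing by `σ⁻¹` collects the two factors at each point, so every summand is a product of
    -- one-variable functions `φ ψ`.
    rw [Finset.prod_mul_distrib, ← Equiv.prod_comp σ.symm
      (fun i => φ (f i) (Sum.elim x y (σ i))), ← Finset.prod_mul_distrib, Fintype.prod_sum_type]
    simp
  simp_rw [hdet]
  refine integrable_finsetSum _ fun σ _ => integrable_finsetSum _ fun f _ => ?_
  exact (Integrable.fintype_prod (f := fun j y => φ (f (σ.symm (.inr j))) y * ψ (f (.inr j)) y)
    fun j => hint _ _).const_mul _

/-- Integrating `m` points out of a determinant with a reproducing kernel. -/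
theorem integral_det_kernelMatrix {μ : Measure X} [SigmaFinite μ] {φ ψ : Fin N → X → ℝ}
    (hint : ∀ r s, Integrable (fun x => φ r x * ψ s x) μ)
    (horth : ∀ r s, ∫ x, φ r x * ψ s x ∂μ = if r = s then 1 else 0) (m : ℕ) :
    ∀ {ι : Type} [Fintype ι] [DecidableEq ι] (x : ι → X),
    ∫ y : Fin m → X, (kernelMatrix φ ψ (Sum.elim x y)).det ∂(Measure.pi fun _ => μ) =
      (∏ k ∈ Finset.range m, ((N : ℝ) - Fintype.card ι - k)) * (kernelMatrix φ ψ x).det := by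
  induction m with
  | zero =>
    intro ι _ _ x
    have : ∀ y : Fin 0 → X, (kernelMatrix φ ψ (Sum.elim x y)).det = (kernelMatrix φ ψ x).det := by
      intro y
      rw [← det_kernelMatrix_comp_equiv φ ψ (Equiv.sumEmpty ι (Fin 0)) x]
      congr 2
      ext (i | i)
      · rfl
      · exact i.elim0
    simp_rw [this]
    rw [Measure.pi_of_empty]
    simp
  | succ m ih =>
    intro ι _ _ x
    -- Moves the first integrated point into the fixed family. The induction hypothesis integrates
    -- the other `m` points, and the one-point formula removes this one.
    let e : (ι ⊕ Unit) ⊕ Fin m ≃ ι ⊕ Fin (m + 1) :=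
      { toFun := Sum.elim (Sum.elim Sum.inl fun _ => Sum.inr 0) fun i => Sum.inr i.succ
        invFun := Sum.elim (fun i => Sum.inl (Sum.inl i))
          (Fin.cases (Sum.inl (Sum.inr ())) fun i => Sum.inr i)
        left_inv := by rintro ((i | i) | i) <;> rfl
        right_inv := by
          rintro (i | i)
          · rfl
          · refine Fin.cases ?_ (fun i => ?_) i <;> rfl }
    have hmp := (measurePreserving_piFinSuccAbove (fun _ : Fin (m + 1) => μ) 0).symm
    have hpt : ∀ p : X × (Fin m → X),
        (kernelMatrix φ ψ (Sum.elim x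
          ((MeasurableEquiv.piFinSuccAbove (fun _ => X) 0).symm p))).det =
        (kernelMatrix φ ψ (Sum.elim (Sum.elim x fun _ : Unit => p.1) p.2)).det := by
      intro p
      rw [← det_kernelMatrix_comp_equiv φ ψ e]
      congr 2
      ext ((i | i) | i)
      · rfl
      · rfl
      · exact Fin.insertNth_apply_succAbove (α := fun _ => X) 0 p.1 p.2 i
    rw [← hmp.integral_comp' , integral_prod]
    · simp_rw [hpt, ih]
      rw [integral_const_mul, integral_det_kernelMatrix_unit hint horth, ← mul_assoc,
        Finset.prod_range_succ']
      congr 1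
      simp [sub_sub, add_assoc, add_comm (1 : ℝ)]
    · exact (hmp.integrable_comp_emb (MeasurableEquiv.measurableEmbedding _)).2
        (integrable_det_kernelMatrix hint x)

end Determinantal

/-! ### Inverting the Gram matrix -/

theorem prod_range_sub_natCast (s m : ℕ) :
    ∏ i ∈ Finset.range m, ((i : ℝ) - s) = (-1) ^ m * (m.factorial * s.choose m) := by
  have h : ∏ i ∈ Finset.range m, ((i : ℝ) - s) = (-1) ^ m * (s.descFactorial m : ℝ) := by
    induction m with
    | zero => simp
    | succ m ih =>
      rw [Finset.prod_range_succ, ih, Nat.descFactorial_succ]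
      rcases le_or_gt m s with h | h
      · push_cast [h]; ring
      · simp [Nat.descFactorial_of_lt h]
  rw [h, Nat.descFactorial_eq_factorial_mul_choose]
  push_cast; rfl

/-- Binomial inversion: `C(r,s) C(s,m) = C(r,m) C(r-m,s-m)` reduces the sum to an alternating row of
Pascal's triangle. -/
theorem sum_alternating_choose_mul_choose (r m : ℕ) :
    ∑ s ∈ Finset.range (r + 1), (-1 : ℝ) ^ s * r.choose s * s.choose m =
      if r = m then (-1) ^ m else 0 := by
  rcases lt_or_ge r m with h | h
  · rw [if_neg h.ne]
    refine Finset.sum_eq_zero fun s hs => ?_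
    rw [Nat.choose_eq_zero_of_lt (n := s) (by simp at hs; omega)]
    simp
  · obtain ⟨k, rfl⟩ := Nat.exists_eq_add_of_le h
    rw [add_assoc, Finset.sum_range_add]
    have h1 : ∑ s ∈ Finset.range m, (-1 : ℝ) ^ s * (m + k).choose s * s.choose m = 0 := by
      refine Finset.sum_eq_zero fun s hs => ?_
      rw [Nat.choose_eq_zero_of_lt (n := s) (by simpa using hs)]
      simp
    have h2 : ∀ t ∈ Finset.range (k + 1), (-1 : ℝ) ^ (m + t) * (m + k).choose (m + t) *
        (m + t).choose m = (-1) ^ m * (m + k).choose m * ((-1) ^ t * k.choose t) := by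
      intro t ht
      have := Nat.choose_mul (n := m + k) (k := m + t) (s := m) (by omega)
      have h3 : ((m + k).choose (m + t) : ℝ) * (m + t).choose m = (m + k).choose m * k.choose t := by
        rw [Nat.add_sub_cancel_left, Nat.add_sub_cancel_left] at this
        exact_mod_cast this
      rw [mul_assoc, h3]; ring
    rw [h1, Finset.sum_congr rfl h2, ← Finset.mul_sum]
    have h4 : ∑ t ∈ Finset.range (k + 1), (-1 : ℝ) ^ t * k.choose t = if k = 0 then 1 else 0 := by
      exact_mod_cast congrArg (Int.cast : ℤ → ℝ) (Int.alternating_sum_range_choose (n := k))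
    rw [h4]
    rcases Nat.eq_zero_or_pos k with rfl | hk
    · simp
    · rw [if_neg hk.ne', if_neg (by omega)]; simp

/-- The denominator of the Lagrange weight at node `l` among the nodes `0, …, l + k`. -/
theorem prod_erase_range_natCast_sub (l k : ℕ) :
    ∏ j ∈ (Finset.range (l + 1 + k)).erase l, ((l : ℝ) - j) =
      (-1) ^ k * (l.factorial * k.factorial) := by
  induction k with
  | zero =>
    have : (Finset.range (l + 1 + 0)).erase l = Finset.range l := by
      ext i; simp; omega
    rw [this]
    have h := prod_range_sub_natCast l l
    rw [Nat.choose_self, Finset.prod_congr (g := fun i : ℕ => -((l : ℝ) - i)) rfl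
      fun i _ => (neg_sub (l : ℝ) i).symm,
      Finset.prod_neg, Finset.card_range] at h
    have := mul_left_cancel₀ (pow_ne_zero l (by norm_num : (-1 : ℝ) ≠ 0)) h
    rw [this]; simp
  | succ k ih =>
    have : (Finset.range (l + 1 + (k + 1))).erase l =
        insert (l + 1 + k) ((Finset.range (l + 1 + k)).erase l) := by
      ext i; simp; omega
    rw [this, Finset.prod_insert (by simp), ih, Nat.factorial_succ]
    push_cast; ring

/-- The rising factorial `a (a + 1) ⋯ (a + N - 1)`. -/
def rising (a : ℝ) (N : ℕ) : ℝ := ∏ j ∈ Finset.range N, (a + j)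

/-- Lagrange interpolation at the nodes `0, …, N - 1`, evaluated at `-a`. -/
theorem sum_eval_mul_rising {N : ℕ} (p : Polynomial ℝ) (hp : p.degree < N) {a : ℝ} (ha : 0 < a) :
    ∑ l ∈ Finset.range N, (-1 : ℝ) ^ l * rising a N /
      ((a + l) * (l.factorial * (N - 1 - l).factorial)) * p.eval (l : ℝ) = p.eval (-a) := by
  have hinj : Set.InjOn (fun l : ℕ => (l : ℝ)) (Finset.range N) := Nat.cast_injective.injOn
  have hp' := Lagrange.eq_interpolate (f := p) hinj (by simpa using hp)
  conv_rhs => rw [hp']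
  rw [Lagrange.eval_interpolate_not_at_node _ (fun l _ => by
    have : (0 : ℝ) ≤ l := Nat.cast_nonneg l
    linarith), Finset.mul_sum]
  refine Finset.sum_congr rfl fun l hl => ?_
  have hl' : l < N := by simpa using hl
  obtain ⟨k, rfl⟩ := Nat.exists_eq_add_of_le (show l + 1 ≤ N from hl')
  have hal : a + l ≠ 0 := by positivity
  rw [Lagrange.nodalWeight, Finset.prod_inv_distrib, prod_erase_range_natCast_sub,
    Lagrange.eval_nodal]
  have h1 : ∏ i ∈ Finset.range (l + 1 + k), (-a - (i : ℝ)) =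
      (-1) ^ (l + 1 + k) * rising a (l + 1 + k) := by
    rw [rising, Finset.prod_congr (g := fun i : ℕ => -(a + i)) rfl
      fun i _ => (show -a - (i : ℝ) = -(a + i) by ring),
      Finset.prod_neg, Finset.card_range]
  rw [h1, show l + 1 + k - 1 - l = k by omega, show -a - (l : ℝ) = -(a + l) by ring]
  have hk : ((-1 : ℝ) ^ k) ≠ 0 := pow_ne_zero _ (by norm_num)
  have hk2 : ((-1 : ℝ) ^ k) * (-1) ^ k = 1 := by rw [← mul_pow]; simp
  have := l.factorial_ne_zero
  have := k.factorial_ne_zero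
  field_simp
  ring

theorem Gamma_add_natCast {t : ℝ} (ht : 0 < t) (m : ℕ) :
    Real.Gamma (t + m) = Real.Gamma t * rising t m := by
  induction m with
  | zero => simp [rising]
  | succ m ih =>
    rw [rising, Finset.prod_range_succ, ← rising, ← mul_assoc, ← ih, Nat.cast_succ, ← add_assoc,
      Real.Gamma_add_one (by positivity), mul_comm]

/-- The inverse of the Gram matrix `Γ(α + 1 + m + θ l)`, `0 ≤ m, l < N`. -/
def gramInv (α θ : ℝ) (N r l : ℕ) : ℝ :=
  (-1) ^ l / (l.factorial * (N - 1 - l).factorial * Real.Gamma (α + 1 + θ * l)) *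
    ((r.factorial : ℝ)⁻¹ * ∑ s ∈ Finset.range (r + 1),
      (-1) ^ s * r.choose s * (rising ((α + 1 + s) / θ) N / ((α + 1 + s) / θ + l)))

/-- With `p(t) = ∏_{i<m} (θ t + α + 1 + i)` one has `Γ(α + 1 + m + θ l) = Γ(α + 1 + θ l) p(l)`, and
`deg p < N`. Interpolation evaluates the sum over `l` as `p` at `-(α + 1 + s)/θ`, where the factors
become `i - s`, so the value is `(-1)^m m! C(s,m)`. Binomial inversion in `s` then isolates `r = m`.
-/
theorem sum_gramInv_mul_Gamma {α θ : ℝ} (hα : -1 < α) (hθ : 0 < θ) {N r m : ℕ} (hm : m < N) :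
    ∑ l ∈ Finset.range N, gramInv α θ N r l * Real.Gamma (α + 1 + m + θ * l) =
      if m = r then 1 else 0 := by
  set p : Polynomial ℝ := ∏ i ∈ Finset.range m, (Polynomial.C θ * Polynomial.X +
    Polynomial.C (α + 1 + i)) with hp
  have hdeg : p.degree < N := by
    have : p.natDegree ≤ ∑ i ∈ Finset.range m, 1 :=
      (Polynomial.natDegree_prod_le _ _).trans
        (Finset.sum_le_sum fun i _ => Polynomial.natDegree_linear_le)
    refine Polynomial.degree_le_natDegree.trans_lt ?_
    simp at this
    exact_mod_cast this.trans_lt hm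
  have heval : ∀ t : ℝ, p.eval t = ∏ i ∈ Finset.range m, (θ * t + (α + 1 + i)) := by
    intro t; rw [hp, Polynomial.eval_prod]; simp
  have hG : ∀ l : ℕ, Real.Gamma (α + 1 + m + θ * l) =
      Real.Gamma (α + 1 + θ * l) * p.eval (l : ℝ) := by
    intro l
    have : 0 < α + 1 + θ * l := by have : (0 : ℝ) ≤ θ * l := by positivity
                                   linarith
    rw [show α + 1 + m + θ * l = α + 1 + θ * l + m by ring, Gamma_add_natCast this, heval, rising]
    congr 1
    exact Finset.prod_congr rfl fun i _ => by ring
  have hap : ∀ s : ℕ, 0 < (α + 1 + s) / θ := fun s => by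
    have : 0 < α + 1 + s := by have : (0 : ℝ) ≤ s := s.cast_nonneg
                               linarith
    positivity
  have h1 : ∀ l ∈ Finset.range N, gramInv α θ N r l * Real.Gamma (α + 1 + m + θ * l) =
      ∑ s ∈ Finset.range (r + 1), (r.factorial : ℝ)⁻¹ * ((-1) ^ s * r.choose s) *
        ((-1 : ℝ) ^ l * rising ((α + 1 + s) / θ) N /
      (((α + 1 + s) / θ + l) * (l.factorial * (N - 1 - l).factorial)) * p.eval (l : ℝ)) := by
    intro l _
    have hg : Real.Gamma (α + 1 + θ * l) ≠ 0 := by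
      refine (Real.Gamma_pos_of_pos ?_).ne'
      have : (0 : ℝ) ≤ θ * l := by positivity
      linarith
    rw [hG, gramInv, Finset.mul_sum, Finset.mul_sum, Finset.sum_mul]
    refine Finset.sum_congr rfl fun s _ => ?_
    have := (add_pos_of_pos_of_nonneg (hap s) (l.cast_nonneg)).ne'
    field_simp
  rw [Finset.sum_congr rfl h1, Finset.sum_comm]
  have h2 : ∀ s ∈ Finset.range (r + 1), (∑ l ∈ Finset.range N,
      (r.factorial : ℝ)⁻¹ * ((-1) ^ s * r.choose s) *
        ((-1 : ℝ) ^ l * rising ((α + 1 + s) / θ) N /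
      (((α + 1 + s) / θ + l) * (l.factorial * (N - 1 - l).factorial)) * p.eval (l : ℝ))) =
      (r.factorial : ℝ)⁻¹ * ((-1) ^ m * m.factorial) * ((-1) ^ s * r.choose s * s.choose m) := by
    intro s _
    rw [← Finset.mul_sum, sum_eval_mul_rising p hdeg (hap s), heval]
    have : ∀ i ∈ Finset.range m, θ * -((α + 1 + s) / θ) + (α + 1 + i) = (i : ℝ) - s := by
      intro i _; field_simp; ring
    rw [Finset.prod_congr rfl this, prod_range_sub_natCast]
    ring
  rw [Finset.sum_congr rfl h2, ← Finset.mul_sum, sum_alternating_choose_mul_choose]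
  rcases eq_or_ne r m with rfl | h
  · have : ((-1 : ℝ) ^ r) * (-1) ^ r = 1 := by rw [← mul_pow]; simp
    have := r.factorial_ne_zero
    rw [if_pos rfl, if_pos rfl]
    field_simp
    linarith
  · rw [if_neg h, if_neg h.symm]; simp

/-! ### Biorthonormal functions -/

/-- The functions `x ^ r` weighted by `x ^ α e ^ {-x}`. -/
def weightedPow (α : ℝ) {N : ℕ} (r : Fin N) (x : ℝ) : ℝ :=
  x ^ (r : ℕ) * (x ^ α * Real.exp (-x))

/-- The combinations of the powers `x ^ (θ l)` that are biorthonormal to `weightedPow`. -/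
def dualPoly (α θ : ℝ) {N : ℕ} (r : Fin N) (x : ℝ) : ℝ :=
  ∑ l : Fin N, gramInv α θ N r l * x ^ (θ * (l : ℕ))

theorem weightedPow_mul_rpow (α θ : ℝ) {N : ℕ} (r : Fin N) (l : ℕ) {x : ℝ} (hx : 0 < x) :
    weightedPow α r x * x ^ (θ * l) = Real.exp (-x) * x ^ ((α + 1 + (r : ℕ) + θ * l) - 1) := by
  rw [weightedPow, show α + 1 + ((r : ℕ) : ℝ) + θ * l - 1 = (r : ℕ) + α + θ * l by ring,
    Real.rpow_add hx, Real.rpow_add hx, Real.rpow_natCast]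
  ring

theorem gramExponent_pos {α θ : ℝ} (hα : -1 < α) (hθ : 0 < θ) (r l : ℕ) :
    0 < α + 1 + r + θ * l := by
  have h1 : (0 : ℝ) ≤ r := r.cast_nonneg
  have h2 : 0 ≤ θ * l := by positivity
  linarith

theorem integrableOn_weightedPow_mul_rpow {α θ : ℝ} (hα : -1 < α) (hθ : 0 < θ) {N : ℕ}
    (r : Fin N) (l : ℕ) :
    IntegrableOn (fun x => weightedPow α r x * x ^ (θ * l)) (Set.Ioi 0) :=
  (Real.GammaIntegral_convergent (gramExponent_pos hα hθ r l)).congr_fun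
    (fun _ hx => (weightedPow_mul_rpow α θ r l hx).symm) measurableSet_Ioi

theorem integral_weightedPow_mul_rpow {α θ : ℝ} (hα : -1 < α) (hθ : 0 < θ) {N : ℕ}
    (r : Fin N) (l : ℕ) :
    ∫ x in Set.Ioi 0, weightedPow α r x * x ^ (θ * l) = Real.Gamma (α + 1 + (r : ℕ) + θ * l) := by
  rw [Real.Gamma_eq_integral (gramExponent_pos hα hθ r l)]
  exact setIntegral_congr_fun measurableSet_Ioi fun _ hx => weightedPow_mul_rpow α θ r l hx

theorem weightedPow_mul_dualPoly (α θ : ℝ) {N : ℕ} (r s : Fin N) (x : ℝ) :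
    weightedPow α r x * dualPoly α θ s x =
      ∑ l : Fin N, gramInv α θ N s l * (weightedPow α r x * x ^ (θ * (l : ℕ))) := by
  rw [dualPoly, Finset.mul_sum]
  exact Finset.sum_congr rfl fun l _ => by ring

theorem integrableOn_weightedPow_mul_dualPoly {α θ : ℝ} (hα : -1 < α) (hθ : 0 < θ) {N : ℕ}
    (r s : Fin N) :
    IntegrableOn (fun x => weightedPow α r x * dualPoly α θ s x) (Set.Ioi 0) := by
  simp_rw [weightedPow_mul_dualPoly]
  exact integrable_finsetSum _ fun l _ =>
    (integrableOn_weightedPow_mul_rpow hα hθ r l).const_mul _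

theorem integral_weightedPow_mul_dualPoly {α θ : ℝ} (hα : -1 < α) (hθ : 0 < θ) {N : ℕ}
    (r s : Fin N) :
    ∫ x in Set.Ioi 0, weightedPow α r x * dualPoly α θ s x = if r = s then 1 else 0 := by
  simp_rw [weightedPow_mul_dualPoly]
  rw [integral_finsetSum Finset.univ fun (l : Fin N) _ =>
    (integrableOn_weightedPow_mul_rpow hα hθ r l).const_mul (gramInv α θ N s l)]
  simp_rw [integral_const_mul, integral_weightedPow_mul_rpow hα hθ]
  rw [Fin.sum_univ_eq_sum_range
    (fun l => gramInv α θ N s l * Real.Gamma (α + 1 + (r : ℕ) + θ * l)) N,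
    sum_gramInv_mul_Gamma hα hθ r.2]
  simp [Fin.ext_iff]

/-! ### Determinantal form of the finite ensemble -/

/-- The inverse Gram matrix of the `N`-point ensemble. -/
def gramInvMatrix (α θ : ℝ) (N : ℕ) : Matrix (Fin N) (Fin N) ℝ :=
  Matrix.of fun r l => gramInv α θ N r l

theorem det_gramInvMatrix_ne_zero {α θ : ℝ} (hα : -1 < α) (hθ : 0 < θ) (N : ℕ) :
    (gramInvMatrix α θ N).det ≠ 0 := by
  have h : gramInvMatrix α θ N *
      Matrix.of (fun l m : Fin N => Real.Gamma (α + 1 + (m : ℕ) + θ * (l : ℕ))) = 1 := by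
    ext r m
    rw [Matrix.mul_apply]
    simp only [gramInvMatrix, Matrix.of_apply]
    rw [Fin.sum_univ_eq_sum_range
      (fun l => gramInv α θ N r l * Real.Gamma (α + 1 + (m : ℕ) + θ * l)) N,
      sum_gramInv_mul_Gamma hα hθ m.2, Matrix.one_apply]
    simp [Fin.ext_iff, eq_comm]
  have h' := congrArg Matrix.det h
  rw [Matrix.det_mul, Matrix.det_one] at h'
  exact left_ne_zero_of_mul_eq_one h'

/-- The kernel matrix of the `N`-point ensemble. -/
abbrev ensembleMatrix (α θ : ℝ) (N : ℕ) {κ : Type} (z : κ → ℝ) : Matrix κ κ ℝ :=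
  kernelMatrix (weightedPow α : Fin N → ℝ → ℝ) (dualPoly α θ) z

/-- The kernel matrix factors as weighted Vandermonde in `x`, inverse Gram matrix, transposed
Vandermonde in `x ^ θ`. Mathlib's Vandermonde product has the opposite orientation to `weight`, but
the sign occurs twice and cancels. -/
theorem det_ensembleMatrix (α θ : ℝ) {N : ℕ} {x : Fin N → ℝ} (hx : x ∈ orthant N) :
    (ensembleMatrix α θ N x).det = (gramInvMatrix α θ N).det * weight α θ x := by
  have h : ensembleMatrix α θ N x =
      Matrix.of (fun i j => x i ^ α * Real.exp (-x i) * Matrix.vandermonde x i j) *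
        gramInvMatrix α θ N * (Matrix.vandermonde fun i => x i ^ θ).transpose := by
    ext i j
    rw [Matrix.mul_assoc, Matrix.mul_apply]
    change ∑ r : Fin N, weightedPow α r (x i) * dualPoly α θ r (x j) = _
    refine Finset.sum_congr rfl fun r _ => ?_
    rw [Matrix.mul_apply, dualPoly, weightedPow]
    congr 1
    · rw [Matrix.of_apply, Matrix.vandermonde_apply, mul_comm]
    · refine Finset.sum_congr rfl fun l _ => ?_
      rw [Matrix.transpose_apply, Matrix.vandermonde_apply, Real.rpow_mul_natCast (hx j).le]
      rfl
  rw [h, Matrix.det_mul, Matrix.det_mul, Matrix.det_transpose, Matrix.det_mul_column,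
    Matrix.det_vandermonde, Matrix.det_vandermonde, weight]
  simp_rw [Finset.prod_mul_distrib]
  have hneg : ∀ v : Fin N → ℝ, ∏ i, ∏ j ∈ Finset.Ioi i, (v j - v i) =
      (∏ i : Fin N, ∏ _j ∈ Finset.Ioi i, (-1)) * ∏ i, ∏ j ∈ Finset.Ioi i, (v i - v j) := by
    intro v
    rw [← Finset.prod_mul_distrib]
    refine Finset.prod_congr rfl fun i _ => ?_
    rw [← Finset.prod_mul_distrib]
    exact Finset.prod_congr rfl fun j _ => by ring
  have hsq : (∏ i : Fin N, ∏ _j ∈ Finset.Ioi i, (-1 : ℝ)) *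
      (∏ i : Fin N, ∏ _j ∈ Finset.Ioi i, (-1 : ℝ)) = 1 := by
    simp_rw [← Finset.prod_mul_distrib]
    simp
  rw [hneg x, hneg fun i => x i ^ θ]
  linear_combination ((∏ i, x i ^ α) * (∏ i, Real.exp (-x i)) *
    (∏ i, ∏ j ∈ Finset.Ioi i, (x i - x j)) * (gramInvMatrix α θ N).det *
    ∏ i, ∏ j ∈ Finset.Ioi i, (x i ^ θ - x j ^ θ)) * hsq

theorem weight_eq {α θ : ℝ} (hα : -1 < α) (hθ : 0 < θ) {N : ℕ} {x : Fin N → ℝ}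
    (hx : x ∈ orthant N) :
    weight α θ x = (gramInvMatrix α θ N).det⁻¹ * (ensembleMatrix α θ N x).det := by
  rw [det_ensembleMatrix α θ hx, inv_mul_cancel_left₀ (det_gramInvMatrix_ne_zero hα hθ N)]

theorem weight_nonneg (α : ℝ) {θ : ℝ} (hθ : 0 < θ) {N : ℕ} {x : Fin N → ℝ}
    (hx : x ∈ orthant N) : 0 ≤ weight α θ x := by
  refine mul_nonneg (Finset.prod_nonneg fun i _ => Finset.prod_nonneg fun j _ => ?_)
    (Finset.prod_nonneg fun i _ => mul_nonneg (Real.rpow_nonneg (hx i).le _) (Real.exp_nonneg _))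
  rcases le_total (x i) (x j) with h | h
  · exact mul_nonneg_of_nonpos_of_nonpos (sub_nonpos.2 h)
      (sub_nonpos.2 (Real.rpow_le_rpow (hx i).le h hθ.le))
  · exact mul_nonneg (sub_nonneg.2 h)
      (sub_nonneg.2 (Real.rpow_le_rpow (hx j).le h hθ.le))

theorem orthant_eq_pi (n : ℕ) : orthant n = Set.univ.pi fun _ => Set.Ioi (0 : ℝ) := by
  ext x; simp [orthant]

theorem measurableSet_orthant (n : ℕ) : MeasurableSet (orthant n) := by
  rw [orthant_eq_pi]
  exact MeasurableSet.univ_pi fun _ => measurableSet_Ioi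

theorem volume_restrict_orthant (n : ℕ) :
    (volume : Measure (Fin n → ℝ)).restrict (orthant n) =
      Measure.pi fun _ => (volume : Measure ℝ).restrict (Set.Ioi 0) := by
  rw [orthant_eq_pi, volume_pi, Measure.restrict_pi_pi]

/-- With `n + m` functions and `n` fixed points the factors `N - n - k` are `m - k`, whose product
is `m!`. -/
theorem integral_det_ensembleMatrix {α θ : ℝ} (hα : -1 < α) (hθ : 0 < θ) (n m : ℕ)
    (x : Fin n → ℝ) :
    ∫ y in orthant m, (ensembleMatrix α θ (n + m) (Sum.elim x y)).det =
      m.factorial * (ensembleMatrix α θ (n + m) x).det := by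
  rw [volume_restrict_orthant, integral_det_kernelMatrix
    (integrableOn_weightedPow_mul_dualPoly hα hθ) (integral_weightedPow_mul_dualPoly hα hθ)]
  congr 1
  rw [← Nat.descFactorial_self, Nat.descFactorial_eq_prod_range, Nat.cast_prod]
  refine Finset.prod_congr rfl fun k hk => ?_
  rw [Nat.cast_sub (by simp at hk; omega)]
  simp

theorem det_ensembleMatrix_elim0 (α θ : ℝ) (N : ℕ) (x : Fin 0 → ℝ) (y : Fin N → ℝ) :
    (ensembleMatrix α θ N (Sum.elim x y)).det = (ensembleMatrix α θ N y).det := by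
  rw [ensembleMatrix, ← det_kernelMatrix_comp_equiv _ _ (Equiv.emptySum (Fin 0) (Fin N)).symm]
  rfl

theorem integrableOn_weight {α θ : ℝ} (hα : -1 < α) (hθ : 0 < θ) (N : ℕ) :
    IntegrableOn (fun x : Fin N → ℝ => weight α θ x) (orthant N) := by
  have h := integrable_det_kernelMatrix
    (integrableOn_weightedPow_mul_dualPoly hα hθ (N := N)) (fun i : Fin 0 => i.elim0)
    (κ := Fin N)
  rw [← volume_restrict_orthant] at h
  refine IntegrableOn.congr_fun (h.const_mul (gramInvMatrix α θ N).det⁻¹) (fun x hx => ?_)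
    (measurableSet_orthant N)
  rw [weight_eq hα hθ hx]
  exact congrArg _ (det_ensembleMatrix_elim0 α θ N _ x)

theorem partitionFunction_eq {α θ : ℝ} (hα : -1 < α) (hθ : 0 < θ) (N : ℕ) :
    partitionFunction α θ N = (gramInvMatrix α θ N).det⁻¹ * N.factorial := by
  rw [partitionFunction, setIntegral_congr_fun (measurableSet_orthant N)
    fun _ hx => weight_eq hα hθ hx, integral_const_mul]
  congr 1
  have h := integral_det_ensembleMatrix hα hθ 0 N (fun i => i.elim0)
  rw [zero_add] at h
  simp_rw [det_ensembleMatrix_elim0] at h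
  rw [h]
  simp

/-- A nonnegative integrand gives `Z_N ≥ 0`, and the formula through the Gram determinant gives `Z_N
≠ 0`; the sign of that determinant is never computed. -/
theorem partitionFunction_pos {α θ : ℝ} (hα : -1 < α) (hθ : 0 < θ) (N : ℕ) :
    0 < partitionFunction α θ N := by
  refine lt_of_le_of_ne (setIntegral_nonneg (measurableSet_orthant N)
    fun _ hx => weight_nonneg α hθ hx) (Ne.symm ?_)
  rw [partitionFunction_eq hα hθ]
  exact mul_ne_zero (inv_ne_zero (det_gramInvMatrix_ne_zero hα hθ N))
    (Nat.cast_ne_zero.2 N.factorial_ne_zero)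

theorem append_mem_orthant {n m : ℕ} {x : Fin n → ℝ} {y : Fin m → ℝ} (hx : x ∈ orthant n)
    (hy : y ∈ orthant m) : Fin.append x y ∈ orthant (n + m) := by
  intro i
  refine Fin.addCases (fun i => ?_) (fun i => ?_) i
  · rw [Fin.append_left]; exact hx i
  · rw [Fin.append_right]; exact hy i

/-- The correlation functions of the ensemble are determinantal. -/
theorem correlation_eq_det {α θ : ℝ} (hα : -1 < α) (hθ : 0 < θ) {N n : ℕ} (hn : n ≤ N)
    {x : Fin n → ℝ} (hx : x ∈ orthant n) :
    correlation α θ N n x = (ensembleMatrix α θ N x).det := by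
  obtain ⟨m, rfl⟩ := Nat.exists_eq_add_of_le hn
  rw [correlation]
  -- The integral runs over dimension `n + m - n`, which equals `m` only propositionally; hence the
  -- general `k`.
  have hsub : ∀ k, k = m → ∫ y in orthant k, jointDensity α θ (Fin.append x y) =
      (m.factorial : ℝ) / (n + m).factorial * (ensembleMatrix α θ (n + m) x).det := by
    rintro k rfl
    have h : ∀ y ∈ orthant k, jointDensity α θ (Fin.append x y) =
        ((n + k).factorial : ℝ)⁻¹ * (ensembleMatrix α θ (n + k) (Sum.elim x y)).det := by
      intro y hy
      rw [jointDensity, partitionFunction_eq hα hθ, weight_eq hα hθ (append_mem_orthant hx hy),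
        ← mul_assoc, mul_inv_rev, inv_mul_cancel_right₀
          (inv_ne_zero (det_gramInvMatrix_ne_zero hα hθ (n + k)))]
      congr 1
      rw [ensembleMatrix, ← det_kernelMatrix_comp_equiv _ _ finSumFinEquiv]
      congr 2
      ext (i | i) <;> simp
    rw [setIntegral_congr_fun (measurableSet_orthant k) h, integral_const_mul,
      integral_det_ensembleMatrix hα hθ]
    ring
  rw [hsub _ (Nat.add_sub_cancel_left n m), ← mul_assoc]
  have h1 := Nat.factorial_mul_descFactorial (Nat.le_add_right n m)
  rw [Nat.add_sub_cancel_left] at h1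
  have h2 : ((n + m).factorial : ℝ) = m.factorial * (n + m).descFactorial n := by
    exact_mod_cast h1.symm
  have h3 : ((n + m).factorial : ℝ) ≠ 0 := Nat.cast_ne_zero.2 (Nat.factorial_ne_zero _)
  rw [← mul_div_assoc, mul_comm ((n + m).descFactorial n : ℝ), ← h2, div_self h3, one_mul]

theorem correlation_nonneg (α : ℝ) {θ : ℝ} (hθ : 0 < θ) (N n : ℕ)
    {x : Fin n → ℝ} (hx : x ∈ orthant n) : 0 ≤ correlation α θ N n x :=
  mul_nonneg (Nat.cast_nonneg _) <| setIntegral_nonneg (measurableSet_orthant _) fun _ hy =>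
    mul_nonneg (inv_nonneg.2 (by
      exact setIntegral_nonneg (measurableSet_orthant _) fun z hz => weight_nonneg α hθ hz))
      (weight_nonneg α hθ (append_mem_orthant hx hy))

/-! ### Rising factorials and Gamma bounds -/

theorem rising_nonneg {a : ℝ} (ha : 0 ≤ a) (N : ℕ) : 0 ≤ rising a N :=
  Finset.prod_nonneg fun j _ => add_nonneg ha j.cast_nonneg

/-- The rising factorial normalized by its growth rate. -/
def risingRatio (a : ℝ) (N : ℕ) : ℝ := rising a N / N.factorial * (N : ℝ) ^ (1 - a)

theorem risingRatio_nonneg {a : ℝ} (ha : 0 ≤ a) (N : ℕ) : 0 ≤ risingRatio a N :=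
  mul_nonneg (div_nonneg (rising_nonneg ha N) (Nat.cast_nonneg _))
    (Real.rpow_nonneg N.cast_nonneg _)

/-- The ratio is the reciprocal of Euler's sequence for `Γ(a)` times `N / (N + a)`. -/
theorem tendsto_risingRatio {a : ℝ} (ha : 0 < a) :
    Tendsto (risingRatio a) atTop (𝓝 (Real.Gamma a)⁻¹) := by
  have h1 := ((Real.GammaSeq_tendsto_Gamma a).inv₀ (Real.Gamma_pos_of_pos ha).ne').mul
    (tendsto_natCast_div_add_atTop a)
  rw [mul_one] at h1
  refine h1.congr' ?_
  filter_upwards [eventually_gt_atTop 0] with N hN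
  have hN' : (0 : ℝ) < N := Nat.cast_pos.2 hN
  have hr : ∏ j ∈ Finset.range (N + 1), (a + j) = rising a N * (a + N) := Finset.prod_range_succ _ _
  rw [Real.GammaSeq, hr, risingRatio, Real.rpow_sub hN', Real.rpow_one]
  have : (N : ℝ) ^ a ≠ 0 := (Real.rpow_pos_of_pos hN' a).ne'
  have : (N.factorial : ℝ) ≠ 0 := Nat.cast_ne_zero.2 N.factorial_ne_zero
  have : a + N ≠ 0 := by positivity
  have : (N : ℝ) + a ≠ 0 := by positivity
  field_simp
  ring

/-- Each factor `(a + j)/(j + 1) = 1 + (a - 1)/(j + 1)` is at most its exponential, and the harmonic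
sum is compared with `log N`, from above or from below according to the sign of `a - 1`. -/
theorem risingRatio_le {a : ℝ} (ha : 0 < a) {N : ℕ} (hN : 0 < N) :
    risingRatio a N ≤ Real.exp a := by
  have hN' : (0 : ℝ) < N := Nat.cast_pos.2 hN
  have h1 : rising a N / N.factorial ≤ Real.exp ((a - 1) * (harmonic N : ℝ)) := by
    have hf : (N.factorial : ℝ) = ∏ j ∈ Finset.range N, ((j : ℝ) + 1) := by
      rw [← Finset.prod_range_add_one_eq_factorial]; push_cast; rfl
    rw [rising, hf, ← Finset.prod_div_distrib, harmonic, Rat.cast_sum, Finset.mul_sum,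
      Real.exp_sum]
    refine Finset.prod_le_prod (fun j _ => by positivity) fun j _ => ?_
    have := Real.add_one_le_exp ((a - 1) * (((j + 1 : ℕ) : ℚ)⁻¹ : ℚ))
    refine le_trans (le_of_eq ?_) this
    push_cast
    field_simp
    ring
  have h2 : (a - 1) * (harmonic N : ℝ) ≤ a + (a - 1) * Real.log N := by
    rcases le_total 1 a with h | h
    · have := harmonic_le_one_add_log N
      nlinarith
    · have h3 := log_add_one_le_harmonic N
      have h4 : Real.log N ≤ Real.log ((N + 1 : ℕ) : ℝ) :=
        Real.log_le_log hN' (by push_cast; linarith)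
      nlinarith
  calc risingRatio a N ≤ Real.exp (a + (a - 1) * Real.log N) * (N : ℝ) ^ (1 - a) := by
        refine mul_le_mul_of_nonneg_right (h1.trans (Real.exp_le_exp.2 h2)) ?_
        exact Real.rpow_nonneg hN'.le _
    _ = Real.exp a := by
        rw [Real.rpow_def_of_pos hN', ← Real.exp_add]
        congr 1; ring

/-- A uniform positive lower bound for the Gamma function on the positive half-line. -/
theorem one_sixth_le_Gamma {t : ℝ} (ht : 0 < t) : 1 / 6 ≤ Real.Gamma t := by
  have h2 : ∀ {u : ℝ}, 2 ≤ u → 1 ≤ Real.Gamma u := fun {u} hu => by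
    have := Real.Gamma_strictMonoOn_Ici.monotoneOn (Set.mem_Ici.2 le_rfl) (Set.mem_Ici.2 hu) hu
    rwa [Real.Gamma_two] at this
  rcases le_total 2 t with h | h
  · linarith [h2 h]
  -- For `t ≤ 2`, `1 ≤ Γ(t + 2) = (t + 1) t Γ(t) ≤ 6 Γ(t)`.
  · have h3 := h2 (show 2 ≤ t + 1 + 1 by linarith)
    rw [Real.Gamma_add_one (by positivity), Real.Gamma_add_one ht.ne'] at h3
    have hG := Real.Gamma_pos_of_pos ht
    nlinarith [mul_nonneg (sub_nonneg.2 h) hG.le, mul_pos ht hG,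
      mul_nonneg (mul_nonneg (sub_nonneg.2 h) ht.le) hG.le]

theorem tendsto_descFactorial_div_pow (k : ℕ) :
    Tendsto (fun N : ℕ => (N.descFactorial k : ℝ) / (N : ℝ) ^ k) atTop (𝓝 1) := by
  have h := isEquivalent_descFactorial k
  exact (Asymptotics.isEquivalent_iff_tendsto_one (by
    filter_upwards [eventually_gt_atTop 0] with N hN
    positivity)).1 h

theorem descFactorial_div_pow_le_one (N k : ℕ) :
    (N.descFactorial k : ℝ) / (N : ℝ) ^ k ≤ 1 :=
  div_le_one_of_le₀ (by exact_mod_cast Nat.descFactorial_le_pow N k) (by positivity)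

/-! ### Edge limit of the kernel and the correlations -/

/-- The coefficients of the correlation kernel in the edge scaling. -/
def scaledCoeff (α θ : ℝ) (N r l : ℕ) : ℝ :=
  (-1) ^ l / (l.factorial * Real.Gamma (α + 1 + θ * l)) *
    ((r.factorial : ℝ)⁻¹ * ∑ s ∈ Finset.range (r + 1), (-1) ^ s * r.choose s *
      (risingRatio ((α + 1 + s) / θ) N * (N.descFactorial (l + 1) / (N : ℝ) ^ (l + 1)) *
        (N : ℝ) ^ (-(((r : ℝ) - s) / θ)) / ((α + 1 + s) / θ + l)))

/-- The exponent collects `1/θ` from the density scaling, `(α + r)/θ` from `x ^ (α + r)` and `l`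
from `y ^ (θ l)`. -/
theorem gramInv_mul_rpow (α : ℝ) {θ : ℝ} (hθ : 0 < θ) {N : ℕ} (r : ℕ) {l : ℕ} (hl : l < N) :
    gramInv α θ N r l * (N : ℝ) ^ (-((α + 1 + r) / θ + l)) = scaledCoeff α θ N r l := by
  have hN' : (0 : ℝ) < N := Nat.cast_pos.2 (by omega)
  have hf : (N.factorial : ℝ) = (N - 1 - l).factorial * N.descFactorial (l + 1) := by
    have := Nat.factorial_mul_descFactorial (show l + 1 ≤ N from hl)
    rw [show N - (l + 1) = N - 1 - l by omega] at this
    exact_mod_cast this.symm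
  rw [gramInv, scaledCoeff, mul_right_comm, Finset.mul_sum, Finset.mul_sum, Finset.mul_sum,
    Finset.mul_sum]
  refine Finset.sum_congr rfl fun s _ => ?_
  have he : (N : ℝ) ^ (-((α + 1 + r) / θ + l)) = (N : ℝ) ^ (1 - (α + 1 + s) / θ) *
      (N : ℝ) ^ (-(((r : ℝ) - s) / θ)) / (N : ℝ) ^ (l + 1) := by
    rw [← Real.rpow_natCast, ← Real.rpow_add hN', ← Real.rpow_sub hN']
    congr 1
    push_cast
    field_simp
    ring
  have hd : (N.descFactorial (l + 1) : ℝ) ≠ 0 := by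
    rw [Nat.cast_ne_zero, Ne, Nat.descFactorial_eq_zero_iff_lt]; omega
  have := (N - 1 - l).factorial_ne_zero
  rw [he, risingRatio, hf]
  field_simp

/-- Summand `s` carries `N ^ (-(r - s)/θ)` times convergent factors, so only `s = r` survives. -/
theorem tendsto_scaledCoeff {α θ : ℝ} (hα : -1 < α) (hθ : 0 < θ) (r l : ℕ) :
    Tendsto (fun N => scaledCoeff α θ N r l) atTop
      (𝓝 ((-1) ^ l / (l.factorial * Real.Gamma (α + 1 + θ * l)) *
        ((r.factorial : ℝ)⁻¹ * ((-1) ^ r * ((Real.Gamma ((α + 1 + r) / θ))⁻¹ /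
          ((α + 1 + r) / θ + l)))))) := by
  have hap : ∀ s : ℕ, 0 < (α + 1 + s) / θ := fun s => by
    have : (0 : ℝ) ≤ s := s.cast_nonneg
    have : 0 < α + 1 + s := by linarith
    positivity
  refine Tendsto.const_mul _ (Tendsto.const_mul _ ?_)
  have hsum : (-1 : ℝ) ^ r * ((Real.Gamma ((α + 1 + r) / θ))⁻¹ / ((α + 1 + r) / θ + l)) =
      ∑ s ∈ Finset.range (r + 1), (-1 : ℝ) ^ s * r.choose s *
        ((Real.Gamma ((α + 1 + s) / θ))⁻¹ * 1 * (if s = r then 1 else 0) /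
          ((α + 1 + s) / θ + l)) := by
    rw [Finset.sum_eq_single r (fun s _ hs => by simp [hs]) (by simp)]
    simp
  rw [hsum]
  refine tendsto_finsetSum _ fun s hs => Tendsto.const_mul _ (Tendsto.div_const ?_ _)
  refine ((tendsto_risingRatio (hap s)).mul (tendsto_descFactorial_div_pow _)).mul ?_
  rcases eq_or_ne s r with rfl | h
  · simp
  · rw [if_neg h]
    have : (s : ℝ) < r := by
      have : s < r := by simp at hs; omega
      exact_mod_cast this
    exact (tendsto_rpow_neg_atTop (div_pos (sub_pos.2 this) hθ)).comp tendsto_natCast_atTop_atTop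

/-- The summable majorant for dominated convergence: `risingRatio` grows at most like `e ^ (s/θ)`
with `s ≤ r`, the binomials sum to `2 ^ r`, and `1/Γ ≤ 6`. -/
theorem abs_scaledCoeff_le {α θ : ℝ} (hα : -1 < α) (hθ : 0 < θ) {N : ℕ} (hN : 0 < N) (r l : ℕ) :
    |scaledCoeff α θ N r l| ≤ 6 * (Real.exp ((α + 1) / θ) / ((α + 1) / θ)) *
      ((2 * Real.exp (1 / θ)) ^ r / r.factorial * (1 / l.factorial)) := by
  have hα' : 0 < (α + 1) / θ := div_pos (by linarith) hθ
  have hap : ∀ s : ℕ, (α + 1) / θ ≤ (α + 1 + s) / θ := fun s => by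
    refine div_le_div_of_nonneg_right ?_ hθ.le
    linarith [(s.cast_nonneg : (0 : ℝ) ≤ s)]
  have hN1 : (1 : ℝ) ≤ N := Nat.one_le_cast.2 hN
  have hterm : ∀ s ∈ Finset.range (r + 1), |(-1) ^ s * r.choose s *
      (risingRatio ((α + 1 + s) / θ) N * (N.descFactorial (l + 1) / (N : ℝ) ^ (l + 1)) *
        (N : ℝ) ^ (-(((r : ℝ) - s) / θ)) / ((α + 1 + s) / θ + l))| ≤
      r.choose s * (Real.exp ((α + 1) / θ) * Real.exp (1 / θ) ^ r / ((α + 1) / θ)) := by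
    intro s hs
    have hsr : (s : ℝ) ≤ r := by
      have : s ≤ r := by simp at hs; omega
      exact_mod_cast this
    have has := hα'.trans_le (hap s)
    have h0 := risingRatio_nonneg has.le N
    rw [abs_mul, abs_mul, abs_pow, abs_neg, abs_one, one_pow, one_mul, Nat.abs_cast]
    refine mul_le_mul_of_nonneg_left ?_ (Nat.cast_nonneg _)
    rw [abs_of_nonneg (by positivity)]
    have h1 : risingRatio ((α + 1 + s) / θ) N ≤
        Real.exp ((α + 1) / θ) * Real.exp (1 / θ) ^ r := by
      refine (risingRatio_le has hN).trans ?_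
      rw [← Real.exp_nat_mul, ← Real.exp_add]
      refine Real.exp_le_exp.2 ?_
      rw [add_div, mul_one_div]
      gcongr
    have h2 := descFactorial_div_pow_le_one N (l + 1)
    have h3 : (N : ℝ) ^ (-(((r : ℝ) - s) / θ)) ≤ 1 :=
      Real.rpow_le_one_of_one_le_of_nonpos hN1
        (neg_nonpos.2 (div_nonneg (sub_nonneg.2 hsr) hθ.le))
    have h4 : (α + 1) / θ ≤ (α + 1 + s) / θ + l := (hap s).trans (by
      linarith [(l.cast_nonneg : (0 : ℝ) ≤ l)])
    refine div_le_div₀ (by positivity) ?_ hα' h4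
    calc _ ≤ (Real.exp ((α + 1) / θ) * Real.exp (1 / θ) ^ r) * 1 * 1 := by gcongr
      _ = _ := by ring
  have hsum : |∑ s ∈ Finset.range (r + 1), (-1) ^ s * r.choose s *
      (risingRatio ((α + 1 + s) / θ) N * (N.descFactorial (l + 1) / (N : ℝ) ^ (l + 1)) *
        (N : ℝ) ^ (-(((r : ℝ) - s) / θ)) / ((α + 1 + s) / θ + l))| ≤
      2 ^ r * (Real.exp ((α + 1) / θ) * Real.exp (1 / θ) ^ r / ((α + 1) / θ)) := by
    refine (Finset.abs_sum_le_sum_abs _ _).trans ((Finset.sum_le_sum hterm).trans (le_of_eq ?_))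
    rw [← Finset.sum_mul]
    congr 1
    exact_mod_cast congrArg (Nat.cast : ℕ → ℝ) (Nat.sum_range_choose r)
  have hg : 0 < α + 1 + θ * l := by simpa using gramExponent_pos hα hθ 0 l
  have hG := one_sixth_le_Gamma hg
  have hpre : |(-1 : ℝ) ^ l / (l.factorial * Real.Gamma (α + 1 + θ * l))| ≤
      6 * (1 / l.factorial) := by
    rw [abs_div, abs_pow, abs_neg, abs_one, one_pow, abs_of_pos (by positivity), div_le_iff₀
      (by positivity)]
    have : (l.factorial : ℝ) ≠ 0 := Nat.cast_ne_zero.2 l.factorial_ne_zero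
    field_simp
    linarith
  rw [scaledCoeff, abs_mul, abs_mul, abs_of_pos (show (0 : ℝ) < (r.factorial : ℝ)⁻¹ by positivity)]
  calc _ ≤ 6 * (1 / (l.factorial : ℝ)) * ((r.factorial : ℝ)⁻¹ *
        (2 ^ r * (Real.exp ((α + 1) / θ) * Real.exp (1 / θ) ^ r / ((α + 1) / θ)))) := by gcongr
    _ = _ := by rw [mul_pow]; ring

theorem summable_pow_div_factorial_mul (u v : ℝ) : Summable fun p : ℕ × ℕ =>
    u ^ p.1 / p.1.factorial * (v ^ p.2 / p.2.factorial) :=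
  summable_mul_of_summable_norm (Real.summable_pow_div_factorial u).norm
    (Real.summable_pow_div_factorial v).norm

theorem summable_kernelTerm {α θ : ℝ} (hα : -1 < α) (hθ : 0 < θ) {x y : ℝ} (hx : 0 < x)
    (hy : 0 < y) : Summable (kernelTerm α θ x y) := by
  -- `36` bounds the two reciprocal Gammas; `θ / (α + 1)` bounds the last factor.
  refine Summable.of_norm_bounded (g := fun p : ℕ × ℕ => 36 * (θ / (α + 1)) *
    (x ^ p.1 / p.1.factorial * ((y ^ θ) ^ p.2 / p.2.factorial)))
    ((summable_pow_div_factorial_mul x (y ^ θ)).mul_left _) ?_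
  rintro ⟨k, l⟩
  have hα' : 0 < α + 1 := by linarith
  have hk : 0 < (α + 1 + k) / θ := by positivity
  have hl : 0 < α + 1 + θ * l := by positivity
  have h1 := one_sixth_le_Gamma hk
  have h2 := one_sixth_le_Gamma hl
  simp only [kernelTerm, Real.norm_eq_abs, abs_mul, abs_div, abs_pow, abs_neg, abs_one, one_pow,
    one_mul, Nat.abs_cast]
  rw [abs_of_pos hx, abs_of_pos hθ, abs_of_pos (Real.Gamma_pos_of_pos hk),
    abs_of_pos (Real.Gamma_pos_of_pos hl), abs_of_pos (Real.rpow_pos_of_pos hy _),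
    abs_of_pos (show 0 < α + 1 + k + θ * l by positivity), Real.rpow_mul_natCast hy.le]
  have hyp := Real.rpow_pos_of_pos hy θ
  calc _ ≤ (x ^ k / (k.factorial * (1 / 6))) * ((y ^ θ) ^ l / (l.factorial * (1 / 6))) *
        (θ / (α + 1)) := by
        have hkl : α + 1 ≤ α + 1 + k + θ * l := by
          have : (0 : ℝ) ≤ k + θ * l := by positivity
          linarith
        gcongr
    _ = _ := by ring

/-- The kernel of the `N`-point ensemble converges in the edge scaling. -/
theorem tendsto_scaled_kernel {α θ : ℝ} (hα : -1 < α) (hθ : 0 < θ) {x y : ℝ} (hx : 0 < x)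
    (hy : 0 < y) :
    Tendsto (fun N : ℕ => 1 / (N : ℝ) ^ (1 / θ) * ∑ r : Fin N,
      weightedPow α r (x / (N : ℝ) ^ (1 / θ)) * dualPoly α θ r (y / (N : ℝ) ^ (1 / θ)))
      atTop (𝓝 (x ^ α * kernel α θ x y)) := by
  have hα' : 0 < α + 1 := by linarith
  have hyp := Real.rpow_pos_of_pos hy θ
  -- Extending the finite sum by zero to all pairs fixes the index set, as dominated convergence
  -- requires.
  have hsum : Tendsto (fun N : ℕ => ∑' p : ℕ × ℕ, if p.1 < N ∧ p.2 < N then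
      scaledCoeff α θ N p.1 p.2 * (x ^ p.1 * (y ^ θ) ^ p.2) else 0) atTop
      (𝓝 (kernel α θ x y)) := by
    refine tendsto_tsum_of_dominated_convergence
      (bound := fun p : ℕ × ℕ => 6 * (Real.exp ((α + 1) / θ) / ((α + 1) / θ)) *
        ((2 * Real.exp (1 / θ) * x) ^ p.1 / p.1.factorial * ((y ^ θ) ^ p.2 / p.2.factorial)))
      ((summable_pow_div_factorial_mul _ _).mul_left _) ?_ ?_
    · rintro ⟨r, l⟩
      have h := (tendsto_scaledCoeff hα hθ r l).mul_const (x ^ r * (y ^ θ) ^ l)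
      have hlim : kernelTerm α θ x y (r, l) = (-1) ^ l / (l.factorial * Real.Gamma (α + 1 + θ * l)) *
        ((r.factorial : ℝ)⁻¹ * ((-1) ^ r * ((Real.Gamma ((α + 1 + r) / θ))⁻¹ /
          ((α + 1 + r) / θ + l)))) * (x ^ r * (y ^ θ) ^ l) := by
        simp only [kernelTerm]
        rw [Real.rpow_mul_natCast hy.le]
        have h1 := (Real.Gamma_pos_of_pos (show 0 < (α + 1 + r) / θ by positivity)).ne'
        have h2 := (Real.Gamma_pos_of_pos (show 0 < α + 1 + θ * l by positivity)).ne'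
        have h3 : (α + 1 + r) / θ + l = (α + 1 + r + θ * l) / θ := by field_simp
        rw [h3]
        generalize Real.Gamma ((α + 1 + r) / θ) = G at *
        generalize Real.Gamma (α + 1 + θ * l) = H at *
        have : α + 1 + r + θ * l ≠ 0 := by positivity
        field_simp
      rw [hlim]
      refine h.congr' ?_
      filter_upwards [eventually_gt_atTop r, eventually_gt_atTop l] with N hr hl
      rw [if_pos ⟨hr, hl⟩]
    · filter_upwards [eventually_gt_atTop 0] with N hN
      rintro ⟨r, l⟩
      dsimp only
      split_ifs
      · rw [Real.norm_eq_abs, abs_mul, abs_of_pos (by positivity : 0 < x ^ r * (y ^ θ) ^ l)]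
        calc _ ≤ 6 * (Real.exp ((α + 1) / θ) / ((α + 1) / θ)) *
              ((2 * Real.exp (1 / θ)) ^ r / r.factorial * (1 / l.factorial)) *
              (x ^ r * (y ^ θ) ^ l) := by
              gcongr
              exact abs_scaledCoeff_le hα hθ hN r l
          _ = _ := by rw [mul_pow _ x]; ring
      · rw [norm_zero]; positivity
  have hexp : Tendsto (fun N : ℕ => Real.exp (-(x / (N : ℝ) ^ (1 / θ)))) atTop (𝓝 1) := by
    have h1 : Tendsto (fun N : ℕ => (N : ℝ) ^ (1 / θ)) atTop atTop :=
      (tendsto_rpow_atTop (by positivity)).comp tendsto_natCast_atTop_atTop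
    have h2 := (Real.continuous_exp.tendsto _).comp (h1.const_div_atTop x).neg
    simpa [Function.comp_def] using h2
  have hlim := (hexp.const_mul (x ^ α)).mul hsum
  rw [mul_one] at hlim
  refine hlim.congr' ?_
  filter_upwards [eventually_gt_atTop 0] with N hN
  have hN' : (0 : ℝ) < N := Nat.cast_pos.2 hN
  have hc := Real.rpow_pos_of_pos hN' (1 / θ)
  have htsum : (∑' p : ℕ × ℕ, if p.1 < N ∧ p.2 < N then
      scaledCoeff α θ N p.1 p.2 * (x ^ p.1 * (y ^ θ) ^ p.2) else 0) =
      ∑ r : Fin N, ∑ l : Fin N, scaledCoeff α θ N r l * (x ^ (r : ℕ) * (y ^ θ) ^ (l : ℕ)) := by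
    rw [tsum_eq_sum (s := Finset.range N ×ˢ Finset.range N)]
    · rw [Finset.sum_product, ← Fin.sum_univ_eq_sum_range (fun r => ∑ l ∈ Finset.range N, _) N]
      refine Finset.sum_congr rfl fun r _ => ?_
      rw [← Fin.sum_univ_eq_sum_range (fun l => _) N]
      refine Finset.sum_congr rfl fun l _ => ?_
      rw [if_pos ⟨r.2, l.2⟩]
    · rintro ⟨r, l⟩ h
      rw [if_neg]
      simpa using h
  rw [htsum, Finset.mul_sum, Finset.mul_sum]
  refine Finset.sum_congr rfl fun r _ => ?_
  rw [dualPoly, Finset.mul_sum, Finset.mul_sum, Finset.mul_sum]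
  refine Finset.sum_congr rfl fun l _ => ?_
  rw [← gramInv_mul_rpow α hθ r l.2, weightedPow, Real.div_rpow hx.le hc.le,
    Real.div_rpow hy.le hc.le, ← Real.rpow_mul hN'.le, ← Real.rpow_mul hN'.le, div_pow,
    ← Real.rpow_mul_natCast hN'.le, Real.rpow_mul_natCast hy.le]
  have he : (N : ℝ) ^ (-((α + 1 + (r : ℕ)) / θ + (l : ℕ))) =
      1 / (N : ℝ) ^ (1 / θ) * (1 / (N : ℝ) ^ (1 / θ * (r : ℕ)) * (1 / (N : ℝ) ^ (1 / θ * α)) *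
        (1 / (N : ℝ) ^ (1 / θ * (θ * (l : ℕ))))) := by
    simp only [one_div]
    simp only [← Real.rpow_neg hN'.le, ← Real.rpow_add hN']
    congr 1
    field_simp
    ring
  rw [he]
  ring

/-- The prefactor `N ^ (-n/θ)` distributes as `N ^ (-1/θ)` into each row of the `n × n` determinant,
which is continuous in its entries. -/
theorem tendsto_scaledCorrelation {α θ : ℝ} (hα : -1 < α) (hθ : 0 < θ) {n : ℕ} {x : Fin n → ℝ}
    (hx : x ∈ orthant n) :
    Tendsto (fun N : ℕ => scaledCorrelation α θ N n x) atTop (𝓝 (edgeCorrelation α θ n x)) := by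
  have hent : Tendsto (fun N : ℕ => (Matrix.of fun i j : Fin n => 1 / (N : ℝ) ^ (1 / θ) *
      ensembleMatrix α θ N (fun i => x i / (N : ℝ) ^ (1 / θ)) i j)) atTop
      (𝓝 (Matrix.of fun i j => x i ^ α * kernel α θ (x i) (x j))) :=
    tendsto_pi_nhds.2 fun i => tendsto_pi_nhds.2 fun j => tendsto_scaled_kernel hα hθ (hx i) (hx j)
  have hdet := ((continuous_id.matrix_det).tendsto _).comp hent
  simp only [id] at hdet
  have hlim := Matrix.det_mul_column (fun i => x i ^ α)
    (Matrix.of fun i j => kernel α θ (x i) (x j))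
  simp only [Matrix.of_apply] at hlim
  rw [hlim] at hdet
  refine hdet.congr' ?_
  filter_upwards [eventually_ge_atTop n, eventually_gt_atTop 0] with N hn hN
  have hN' : (0 : ℝ) < N := Nat.cast_pos.2 hN
  have hc := Real.rpow_pos_of_pos hN' (1 / θ)
  rw [scaledCorrelation, correlation_eq_det hα hθ hn fun i => div_pos (hx i) hc]
  have h1 := Matrix.det_smul
    (ensembleMatrix α θ N (fun i => x i / (N : ℝ) ^ (1 / θ))) (1 / (N : ℝ) ^ (1 / θ))
  rw [Fintype.card_fin, div_pow, one_pow, ← Real.rpow_mul_natCast hN'.le,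
    one_div_mul_eq_div] at h1
  rw [one_div_mul_eq_div, ← one_div_mul_eq_div θ (n : ℝ)]
  exact h1

theorem edgeCorrelation_nonneg {α θ : ℝ} (hα : -1 < α) (hθ : 0 < θ) {n : ℕ} {x : Fin n → ℝ}
    (hx : x ∈ orthant n) : 0 ≤ edgeCorrelation α θ n x := by
  refine ge_of_tendsto (tendsto_scaledCorrelation hα hθ hx) ?_
  filter_upwards [eventually_gt_atTop 0] with N hN
  have hN' : (0 : ℝ) < N := Nat.cast_pos.2 hN
  exact mul_nonneg (by positivity)
    (correlation_nonneg α hθ N n fun i => div_pos (hx i) (Real.rpow_pos_of_pos hN' _))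

/-! ### Symmetry of the limit and invariance of the measures -/

/-- The series agree term by term after swapping `k` and `l`: the two Gamma factors trade places,
and the last fraction supplies the factor `θ`. -/
theorem kernel_symm {θ : ℝ} (α : ℝ) (hθ : 0 < θ) {x y : ℝ} (hx : 0 < x) (hy : 0 < y) :
    kernel α θ (y ^ (1 / θ)) (x ^ (1 / θ)) = θ * kernel ((α + 1) / θ - 1) (1 / θ) x y := by
  rw [kernel, kernel, ← tsum_mul_left, ← (Equiv.prodComm ℕ ℕ).tsum_eq]
  refine tsum_congr fun ⟨k, l⟩ => ?_
  simp only [kernelTerm, Equiv.prodComm_apply, Prod.swap_prod_mk]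
  have h1 : ((α + 1) / θ - 1 + 1 + k) / (1 / θ) = α + 1 + θ * k := by field_simp; ring
  have h2 : (α + 1) / θ - 1 + 1 + 1 / θ * l = (α + 1 + l) / θ := by field_simp; ring
  have h3 : 1 / θ / ((α + 1) / θ - 1 + 1 + k + 1 / θ * l) = 1 / (α + 1 + l + θ * k) := by
    rw [show (α + 1) / θ - 1 + 1 + k + 1 / θ * l = (α + 1 + l + θ * k) / θ by field_simp; ring,
      div_div_div_cancel_right₀ hθ.ne']
  have h4 : (x ^ (1 / θ)) ^ (θ * (k : ℝ)) = x ^ k := by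
    rw [← Real.rpow_mul hx.le, ← Real.rpow_natCast]
    congr 1; field_simp
  have h5 : (y ^ (1 / θ)) ^ l = y ^ (1 / θ * (l : ℝ)) := by rw [Real.rpow_mul_natCast hy.le]
  rw [h1, h2, h3, h4, h5]
  ring

/-- In the Jacobian, `θ ^ n` enters the determinant, where the symmetry yields the transposed kernel
matrix, and `x ^ (θ - 1)` restores the exponent `α`. -/
theorem edgeCorrelation_powMap {θ : ℝ} (α : ℝ) (hθ : 0 < θ) {n : ℕ} {x : Fin n → ℝ}
    (hx : x ∈ orthant n) :
    (∏ i, θ * x i ^ (θ - 1)) * edgeCorrelation ((α + 1) / θ - 1) (1 / θ) n (powMap θ n x) =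
      edgeCorrelation α θ n x := by
  have hk : ∀ i j, θ * kernel ((α + 1) / θ - 1) (1 / θ) (x i ^ θ) (x j ^ θ) =
      kernel α θ (x j) (x i) := by
    intro i j
    rw [← kernel_symm α hθ (Real.rpow_pos_of_pos (hx i) θ) (Real.rpow_pos_of_pos (hx j) θ), one_div,
      Real.rpow_rpow_inv (hx i).le hθ.ne', Real.rpow_rpow_inv (hx j).le hθ.ne']
  have hdet := Matrix.det_smul (Matrix.of fun i j : Fin n =>
    kernel ((α + 1) / θ - 1) (1 / θ) (x i ^ θ) (x j ^ θ)) θ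
  have hdet2 : (θ • Matrix.of fun i j : Fin n =>
      kernel ((α + 1) / θ - 1) (1 / θ) (x i ^ θ) (x j ^ θ)) =
      (Matrix.of fun i j : Fin n => kernel α θ (x i) (x j)).transpose := by
    ext i j; exact hk i j
  rw [hdet2, Matrix.det_transpose, Fintype.card_fin] at hdet
  rw [edgeCorrelation, edgeCorrelation, hdet]
  simp only [powMap]
  rw [Finset.prod_mul_distrib, Finset.prod_const, Finset.card_univ, Fintype.card_fin]
  have hp : ∏ i, x i ^ α = (∏ i, x i ^ (θ - 1)) * ∏ i, (x i ^ θ) ^ ((α + 1) / θ - 1) := by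
    rw [← Finset.prod_mul_distrib]
    refine Finset.prod_congr rfl fun i _ => ?_
    rw [← Real.rpow_mul (hx i).le, ← Real.rpow_add (hx i)]
    congr 1; field_simp; ring
  rw [hp]
  ring

theorem powMap_mem_orthant {n : ℕ} {x : Fin n → ℝ} (c : ℝ) (hx : x ∈ orthant n) :
    powMap c n x ∈ orthant n := fun i => Real.rpow_pos_of_pos (hx i) c

theorem powMap_inv_powMap {c : ℝ} (hc : c ≠ 0) {n : ℕ} {x : Fin n → ℝ} (hx : x ∈ orthant n) :
    powMap c⁻¹ n (powMap c n x) = x :=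
  funext fun i => Real.rpow_rpow_inv (hx i).le hc

theorem measurable_powMap (c : ℝ) (n : ℕ) : Measurable (powMap c n) :=
  measurable_pi_lambda _ fun i => (measurable_pi_apply i).pow_const c

/-- The derivative of `powMap`. -/
def powMapDeriv (c : ℝ) (n : ℕ) (x : Fin n → ℝ) : (Fin n → ℝ) →L[ℝ] (Fin n → ℝ) :=
  ContinuousLinearMap.pi fun i =>
    (ContinuousLinearMap.toSpanSingleton ℝ (c * x i ^ (c - 1))).comp (ContinuousLinearMap.proj i)

theorem hasFDerivAt_powMap (c : ℝ) {n : ℕ} {x : Fin n → ℝ} (hx : x ∈ orthant n) :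
    HasFDerivAt (powMap c n) (powMapDeriv c n x) x :=
  hasFDerivAt_pi.2 fun i =>
    HasFDerivAt.comp (g := fun t : ℝ => t ^ c) (f := fun z : Fin n → ℝ => z i) x
      (Real.hasDerivAt_rpow_const (Or.inl (hx i).ne')).hasFDerivAt (hasFDerivAt_apply i x)

theorem det_powMapDeriv (c : ℝ) (n : ℕ) (x : Fin n → ℝ) :
    (powMapDeriv c n x).det = ∏ i, c * x i ^ (c - 1) := by
  rw [powMapDeriv, ContinuousLinearMap.det_pi]
  simp only [ContinuousLinearMap.det_toSpanSingleton]

theorem edgeMeasure_map_powMap {θ : ℝ} (α : ℝ) (hθ : 0 < θ) (n : ℕ) :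
    (edgeMeasure α θ n).map (powMap θ n) = edgeMeasure ((α + 1) / θ - 1) (1 / θ) n := by
  ext s hs
  have ht : MeasurableSet (powMap θ n ⁻¹' s) := measurable_powMap θ n hs
  rw [Measure.map_apply (measurable_powMap θ n) hs, edgeMeasure, edgeMeasure,
    withDensity_apply _ ht, withDensity_apply _ hs, Measure.restrict_restrict ht,
    Measure.restrict_restrict hs]
  have himage : s ∩ orthant n = powMap θ n '' (powMap θ n ⁻¹' s ∩ orthant n) := by
    ext y
    constructor
    · rintro ⟨hys, hy⟩
      have h := powMap_inv_powMap (inv_ne_zero hθ.ne') hy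
      rw [inv_inv] at h
      exact ⟨powMap θ⁻¹ n y, ⟨by rwa [Set.mem_preimage, h], powMap_mem_orthant _ hy⟩, h⟩
    · rintro ⟨x, ⟨hxs, hx⟩, rfl⟩
      exact ⟨hxs, powMap_mem_orthant θ hx⟩
  have hmeas := ht.inter (measurableSet_orthant n)
  rw [himage, lintegral_image_eq_lintegral_abs_det_fderiv_mul volume hmeas
    (fun x hx => (hasFDerivAt_powMap θ hx.2).hasFDerivWithinAt)
    (fun x hx y hy hxy => by
      rw [← powMap_inv_powMap hθ.ne' hx.2, hxy, powMap_inv_powMap hθ.ne' hy.2])]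
  refine setLIntegral_congr_fun hmeas fun x hx => ?_
  have hpos : 0 ≤ ∏ i, θ * x i ^ (θ - 1) :=
    Finset.prod_nonneg fun i _ => mul_nonneg hθ.le (Real.rpow_nonneg (hx.2 i).le _)
  rw [det_powMapDeriv, abs_of_nonneg hpos, ← ENNReal.ofReal_mul hpos,
    edgeCorrelation_powMap α hθ hx.2]

end LaguerreBE

end

open LaguerreBE in
theorem corollary4p7 (α θ : ℝ) (hα : -1 < α) (hθ : 0 < θ) :
    -- the finite ensembles are well defined
    (∀ N : ℕ, IntegrableOn (fun x : Fin N → ℝ => weight α θ x) (orthant N) ∧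
      0 < partitionFunction α θ N) ∧
    -- the series of the limit kernel converges absolutely, and the kernel has the symmetry
    (∀ x y : ℝ, 0 < x → 0 < y →
      Summable (kernelTerm α θ x y) ∧
      kernel α θ (y ^ (1 / θ)) (x ^ (1 / θ)) = θ * kernel ((α + 1) / θ - 1) (1 / θ) x y) ∧
    ∀ n : ℕ, 1 ≤ n →
      -- the edge limit of the correlation functions
      (∀ x ∈ orthant n,
        Filter.Tendsto (fun N : ℕ => scaledCorrelation α θ N n x) Filter.atTop
          (nhds (edgeCorrelation α θ n x)) ∧
        0 ≤ edgeCorrelation α θ n x) ∧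
      -- invariance of the limit correlation measures
      (edgeMeasure ((α + 1) / θ - 1) (1 / θ) n).map (powMap (1 / θ) n) = edgeMeasure α θ n ∧
      (edgeMeasure α θ n).map (powMap θ n) = edgeMeasure ((α + 1) / θ - 1) (1 / θ) n := by
  refine ⟨fun N => ⟨integrableOn_weight hα hθ N, partitionFunction_pos hα hθ N⟩,
    fun x y hx hy => ⟨summable_kernelTerm hα hθ hx hy, kernel_symm α hθ hx hy⟩,
    fun n _ => ⟨fun x hx => ⟨tendsto_scaledCorrelation hα hθ hx, edgeCorrelation_nonneg hα hθ hx⟩,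
      ?_, edgeMeasure_map_powMap α hθ n⟩⟩
  -- The parameter change is an involution, so this direction is the other one at the dual
  -- parameters.
  rw [edgeMeasure_map_powMap _ (one_div_pos.2 hθ) n, one_div_one_div]
  congr 1
  field_simp
  ring
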